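/- Fix an integer $k\ge 0$. Let $\mathcal L$ be the set of all line segments joining two consecutive integral points on a line of slope $0$, $\infty$ or $-1$ through integral points of $\mathbb Z^2$. Let $p,q$ be coprime integers with $p\neq 0$, $q\neq 0$ and $p+q\neq 0$ (that is, the straight segment $\gamma$ from $(0,0)$ to $(p,q)$, oriented towards $(p,q)$, does not run along a line of $\mathcal L$). Let $\tau_1,\dots,\tau_n$ be the line segments of $\mathcal L$ whose interiors are crossed by $\gamma$, in the order in which $\gamma$ crosses them. The fence poset $\mathcal P_{(p,q)}$ has the elements $(\tau_i,j)$, $1\le i\le n$, $0\le j\le k$, and the order generated by the following relations: $(\tau_i,0)\succ(\tau_i,1)\succ\cdots\succ(\tau_i,k)$ if the crossing point of $\gamma$ with $\tau_i$ is strictly closer to the endpoint of $\tau_i$ lying to the right of $\gamma$, and $(\tau_i,0)\prec(\tau_i,1)\prec\cdots\prec(\tau_i,k)$ otherwise; and, for $1\le i<n$, $(\tau_i,k)\succ(\tau_{i+1},0)$ if the common endpoint of $\tau_i$ and $\tau_{i+1}$ lies to the right of $\gamma$, and $(\tau_i,k)\prec(\tau_{i+1},0)$ if it lies to the left. Write $h=n(k+1)$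 and list the elements along $\gamma$ as $\mathcal P_{(p,q)}(1)=(\tau_1,0),\dots,\mathcal P_{(p,q)}(h)=(\tau_n,k)$. Let $m^{(k)}_{\frac qp}$ be the number of order ideals (downward closed subsets, including $\emptyset$) of $\mathcal P_{(p,q)}$. Let $\mathcal P^\circ_{\frac qp}$ be the poset whose elements are those of $\mathcal P_{(p,q)}$ together with $3k+3$ new elements $H(1),\dots,H(3k+3)$, with the order generated by that of $\mathcal P_{(p,q)}$ and the relations $H(i)\succ H(i+1)$ for $1\le i<3k+3$, $H(3k+3)\prec \mathcal P_{(p,q)}(1)$ and $\mathcal P_{(p,q)}(h)\prec H(1)$. Then the number of order ideals of $\mathcal P^\circ_{\frac qp}$ is $(3+3k)\,m^{(k)}_{\frac qp}-k$. -/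

import Mathlib

namespace KMarkov

/-- The directions of the lines of slope `0`, `∞` and `-1`. -/
inductive Dir
  | horizontal
  | vertical
  | diagonal

/-- The vector between consecutive integral points on a line of the given direction. -/
def Dir.vec : Dir → ℤ × ℤ
  | .horizontal => (1, 0)
  | .vertical => (0, 1)
  | .diagonal => (-1, 1)

/-- A line segment of the lattice `𝓛`: it joins two consecutive integral points on a line of
slope `0`, `∞` or `-1` through integral points. -/
structure Edge where
  src : ℤ × ℤ
  dir : Dir

/-- The second endpoint of a line segment of `𝓛`. -/
def Edge.tgt (τ : Edge) : ℤ × ℤ := τ.src + τ.dir.vec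

/-- `v` is an endpoint of the line segment `τ`. -/
def Edge.IsEndpoint (τ : Edge) (v : ℤ × ℤ) : Prop := v = τ.src ∨ v = τ.tgt

/-- `v` lies strictly to the left of the line through the origin directed towards `(p, q)`. -/
def LeftOf (p q : ℤ) (v : ℤ × ℤ) : Prop := 0 < p * v.2 - q * v.1

/-- `v` lies strictly to the right of the line through the origin directed towards `(p, q)`. -/
def RightOf (p q : ℤ) (v : ℤ × ℤ) : Prop := p * v.2 - q * v.1 < 0

/-- A crossing of the straight segment `γ` from `(0,0)` to `(p,q)` with a line segment of `𝓛`: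
the two open segments meet transversally in the point `t • (p, q)`, which is also the point of
`edge` at parameter `s` (`s = 0` is `edge.src`, `s = 1` is `edge.tgt`). By transversality `s` and
`t` are determined by `edge`. -/
structure Crossing (p q : ℤ) where
  edge : Edge
  s : ℝ
  t : ℝ
  s_pos : 0 < s
  s_lt_one : s < 1
  t_pos : 0 < t
  t_lt_one : t < 1
  meet_fst : (edge.src.1 : ℝ) + s * (edge.dir.vec.1 : ℝ) = t * (p : ℝ)
  meet_snd : (edge.src.2 : ℝ) + s * (edge.dir.vec.2 : ℝ) = t * (q : ℝ)
  transversal : p * edge.dir.vec.2 - q * edge.dir.vec.1 ≠ 0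

/-- The intersection point is strictly closer to the endpoint of the line segment that lies to
the right of `γ`. -/
def Crossing.CloserToRight {p q : ℤ} (c : Crossing p q) : Prop :=
  (RightOf p q c.edge.src ∧ c.s < 1 / 2) ∨ (RightOf p q c.edge.tgt ∧ 1 / 2 < c.s)

/-- `γ` crosses the line segments of `c` and `c'` consecutively, in this order. -/
def Crossing.Consecutive {p q : ℤ} (c c' : Crossing p q) : Prop :=
  c.t < c'.t ∧ ∀ d : Crossing p q, ¬ (c.t < d.t ∧ d.t < c'.t)

/-- The underlying set of the fence poset of the segment `γ` from `(0,0)` to `(p,q)`: the pairs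
`(τ, i)` where `τ` is a crossed line segment and `0 ≤ i ≤ k`. -/
@[ext] structure Fence (k : ℕ) (p q : ℤ) where
  crossing : Crossing p q
  level : Fin (k + 1)

/-- A relation that only relates neighbours of a linear order, each pair in one direction, has an
antisymmetric reflexive transitive closure. -/
theorem antisymm_of_neighbours {α β : Type*} [LinearOrder β] (f : α → β)
    (hf : Function.Injective f) (R : α → α → Prop)
    (hadj : ∀ x y, R x y → (f x < f y ∧ ∀ z, ¬ (f x < f z ∧ f z < f y)) ∨
      (f y < f x ∧ ∀ z, ¬ (f y < f z ∧ f z < f x)))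
    (hasym : ∀ x y, R x y → ¬ R y x) {x y : α} (hxy : Relation.ReflTransGen R x y)
    (hyx : Relation.ReflTransGen R y x) : x = y := by
  rcases hxy.cases_head with h | ⟨z, hxz, hzy⟩
  · exact h
  exfalso
  have hzx := hzy.trans hyx
  rcases hadj x z hxz with ⟨h1, h2⟩ | ⟨h1, h2⟩
  · have key : ∀ w, Relation.ReflTransGen R z w → f z ≤ f w := by
      intro w hw
      induction hw with
      | refl => exact le_rfl
      | @tail b c _ hbc ih =>
        rcases hadj b c hbc with ⟨h3, _⟩ | ⟨h3, h4⟩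
        · exact ih.trans h3.le
        · by_contra hlt
          rw [not_le] at hlt
          have hzb : z = b := by
            by_contra hne
            exact h4 z ⟨hlt, lt_of_le_of_ne ih (fun h => hne (hf h))⟩
          subst hzb
          have hcx : c = x := by
            apply hf
            rcases lt_trichotomy (f c) (f x) with h | h | h
            · exact absurd ⟨h, h1⟩ (h4 x)
            · exact h
            · exact absurd ⟨h, h3⟩ (h2 c)
          subst hcx
          exact hasym _ _ hxz hbc
    exact absurd (key x hzx) (not_le.mpr h1)
  · have key : ∀ w, Relation.ReflTransGen R z w → f w ≤ f z := by
      intro w hw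
      induction hw with
      | refl => exact le_rfl
      | @tail b c _ hbc ih =>
        rcases hadj b c hbc with ⟨h3, h4⟩ | ⟨h3, _⟩
        · by_contra hlt
          rw [not_le] at hlt
          have hzb : z = b := by
            by_contra hne
            exact h4 z ⟨lt_of_le_of_ne ih (fun h => hne (hf h.symm)), hlt⟩
          subst hzb
          have hcx : c = x := by
            apply hf
            rcases lt_trichotomy (f c) (f x) with h | h | h
            · exact absurd ⟨h3, h⟩ (h2 c)
            · exact h
            · exact absurd ⟨h1, h⟩ (h4 x)
          subst hcx
          exact hasym _ _ hxz hbc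
        · exact h3.le.trans ih
    exact absurd (key x hzx) (not_le.mpr h1)

theorem int_eq_of_add_eq {a b : ℤ} {s s' : ℝ} (h0 : 0 < s) (h1 : s < 1) (h0' : 0 < s')
    (h1' : s' < 1) (h : (a : ℝ) + s = b + s') : a = b := by
  have h2 : ((a : ℝ)) < b + 1 := by linarith
  have h3 : ((b : ℝ)) < a + 1 := by linarith
  norm_cast at h2 h3
  omega

theorem int_ne_add {a b : ℤ} {s : ℝ} (h0 : 0 < s) (h1 : s < 1) : (a : ℝ) + s ≠ b := by
  intro h
  have h2 : ((a : ℝ)) < b := by linarith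
  have h3 : ((b : ℝ)) < a + 1 := by linarith
  norm_cast at h2 h3
  omega

/-- Different crossings occur at different times. -/
theorem Crossing.t_injective {p q : ℤ} :
    Function.Injective (fun c : Crossing p q => c.t) := by
  rintro ⟨⟨⟨a, b⟩, d⟩, s, t, s0, s1, t0, t1, m1, m2, tr⟩
    ⟨⟨⟨a', b'⟩, d'⟩, s', t', s0', s1', t0', t1', m1', m2', tr'⟩ h
  simp only at h
  subst h
  rw [← m1] at m1'
  rw [← m2] at m2'
  have main : d = d' ∧ a = a' ∧ b = b' ∧ s = s' := by
    cases d <;> cases d' <;>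
      simp only [Dir.vec, Int.cast_one, Int.cast_zero, mul_one, mul_zero, add_zero,
        Int.cast_neg, mul_neg] at m1' m2'
    · have ha := int_eq_of_add_eq s0' s1' s0 s1 m1'
      subst ha
      exact ⟨rfl, rfl, by exact_mod_cast m2'.symm, by linarith⟩
    · exact absurd m2' (int_ne_add s0' s1')
    · exact absurd m2' (int_ne_add s0' s1')
    · exact absurd m2'.symm (int_ne_add s0 s1)
    · have hb := int_eq_of_add_eq s0' s1' s0 s1 m2'
      subst hb
      exact ⟨rfl, by exact_mod_cast m1'.symm, rfl, by linarith⟩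
    · exact absurd (by linarith : (a : ℝ) + s' = a') (int_ne_add s0' s1')
    · exact absurd m2'.symm (int_ne_add s0 s1)
    · exact absurd (by linarith : (a' : ℝ) + s = a) (int_ne_add s0 s1)
    · have hb := int_eq_of_add_eq s0' s1' s0 s1 m2'
      subst hb
      have hs : s = s' := by linarith
      subst hs
      exact ⟨rfl, by exact_mod_cast (by linarith : (a : ℝ) = a'), rfl, rfl⟩
  obtain ⟨rfl, rfl, rfl, rfl⟩ := main
  rfl

/-- A line segment is determined by two different endpoints. -/
theorem Edge.eq_of_endpoints {τ τ' : Edge} {v w : ℤ × ℤ} (hvw : v ≠ w) (h1 : τ.IsEndpoint v)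
    (h2 : τ.IsEndpoint w) (h3 : τ'.IsEndpoint v) (h4 : τ'.IsEndpoint w) : τ = τ' := by
  obtain ⟨⟨a, b⟩, d⟩ := τ
  obtain ⟨⟨a', b'⟩, d'⟩ := τ'
  obtain ⟨x, y⟩ := v
  obtain ⟨x', y'⟩ := w
  cases d <;> cases d' <;>
    simp only [Edge.IsEndpoint, Edge.tgt, Dir.vec, Prod.mk_add_mk, Prod.mk.injEq, ne_eq,
      Edge.mk.injEq, and_true, reduceCtorEq, and_false] at * <;> omega

namespace Fence

/-- The generating relations `x ≺ y` of the fence poset. -/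
inductive Step {k : ℕ} {p q : ℤ} : Fence k p q → Fence k p q → Prop
  | chainDown (c : Crossing p q) (i : Fin k) (h : c.CloserToRight) :
      Step ⟨c, i.succ⟩ ⟨c, i.castSucc⟩
  | chainUp (c : Crossing p q) (i : Fin k) (h : ¬ c.CloserToRight) :
      Step ⟨c, i.castSucc⟩ ⟨c, i.succ⟩
  | linkDown (c c' : Crossing p q) (v : ℤ × ℤ) (h : c.Consecutive c')
      (hc : c.edge.IsEndpoint v) (hc' : c'.edge.IsEndpoint v) (hv : RightOf p q v) :
      Step ⟨c', 0⟩ ⟨c, Fin.last k⟩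
  | linkUp (c c' : Crossing p q) (v : ℤ × ℤ) (h : c.Consecutive c')
      (hc : c.edge.IsEndpoint v) (hc' : c'.edge.IsEndpoint v) (hv : LeftOf p q v) :
      Step ⟨c, Fin.last k⟩ ⟨c', 0⟩

/-- The place of an element in the left-to-right reading of the fence along `γ`. -/
noncomputable def place {k : ℕ} {p q : ℤ} (x : Fence k p q) : ℝ ×ₗ Fin (k + 1) :=
  toLex (x.crossing.t, x.level)

theorem place_injective {k : ℕ} {p q : ℤ} :
    Function.Injective (place : Fence k p q → ℝ ×ₗ Fin (k + 1)) := by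
  intro x y h
  have h' : (x.crossing.t, x.level) = (y.crossing.t, y.level) := h
  rw [Prod.mk.injEq] at h'
  exact Fence.ext (Crossing.t_injective h'.1) h'.2

theorem place_lt {k : ℕ} {p q : ℤ} {x y : Fence k p q} :
    place x < place y ↔ x.crossing.t < y.crossing.t ∨
      (x.crossing.t = y.crossing.t ∧ x.level < y.level) := by
  simp [place, Prod.Lex.toLex_lt_toLex]

theorem chain_neighbours {k : ℕ} {p q : ℤ} (c : Crossing p q) (i : Fin k) :
    place (⟨c, i.castSucc⟩ : Fence k p q) < place (⟨c, i.succ⟩ : Fence k p q) ∧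
      ∀ z : Fence k p q, ¬ (place (⟨c, i.castSucc⟩ : Fence k p q) < place z ∧
        place z < place (⟨c, i.succ⟩ : Fence k p q)) := by
  refine ⟨place_lt.mpr (Or.inr ⟨rfl, Fin.castSucc_lt_succ⟩), ?_⟩
  rintro ⟨d, j⟩ ⟨h1, h2⟩
  rw [place_lt] at h1 h2
  simp only [Fin.lt_def, Fin.val_castSucc, Fin.val_succ] at h1 h2
  rcases h1 with h1 | ⟨h1, h1'⟩ <;> rcases h2 with h2 | ⟨h2, h2'⟩
  · exact lt_asymm h1 h2
  · exact h1.ne h2.symm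
  · exact h2.ne h1.symm
  · omega

theorem link_neighbours {k : ℕ} {p q : ℤ} (c c' : Crossing p q) (h : c.Consecutive c') :
    place (⟨c, Fin.last k⟩ : Fence k p q) < place (⟨c', 0⟩ : Fence k p q) ∧
      ∀ z : Fence k p q, ¬ (place (⟨c, Fin.last k⟩ : Fence k p q) < place z ∧
        place z < place (⟨c', 0⟩ : Fence k p q)) := by
  refine ⟨place_lt.mpr (Or.inl h.1), ?_⟩
  rintro ⟨d, j⟩ ⟨h1, h2⟩
  rw [place_lt] at h1 h2
  rcases h1 with h1 | ⟨_, h1'⟩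
  · rcases h2 with h2 | ⟨_, h2'⟩
    · exact h.2 d ⟨h1, h2⟩
    · exact absurd h2' (Fin.not_lt_zero _)
  · exact absurd (Fin.le_last j) (not_le.mpr h1')

theorem Step.neighbours {k : ℕ} {p q : ℤ} (x y : Fence k p q) (h : Step x y) :
    (place x < place y ∧ ∀ z : Fence k p q, ¬ (place x < place z ∧ place z < place y)) ∨
      (place y < place x ∧ ∀ z : Fence k p q, ¬ (place y < place z ∧ place z < place x)) := by
  cases h with
  | chainDown c i h => exact Or.inr (chain_neighbours c i)
  | chainUp c i h => exact Or.inl (chain_neighbours c i)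
  | linkDown c c' v h hc hc' hv => exact Or.inr (link_neighbours c c' h)
  | linkUp c c' v h hc hc' hv => exact Or.inl (link_neighbours c c' h)

theorem Step.asymm {k : ℕ} {p q : ℤ} (x y : Fence k p q) (h : Step x y) : ¬ Step y x := by
  have hlink : ∀ (c c' : Crossing p q) (v w : ℤ × ℤ), c.Consecutive c' → c.edge.IsEndpoint v →
      c'.edge.IsEndpoint v → RightOf p q v → c.edge.IsEndpoint w → c'.edge.IsEndpoint w →
      ¬ LeftOf p q w := by
    intro c c' v w h h1 h2 h3 h4 h5 h6
    have hne : v ≠ w := by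
      rintro rfl
      exact lt_asymm h3 h6
    have he := Edge.eq_of_endpoints hne h1 h4 h2 h5
    have hp : (0 : ℝ) < c'.t - c.t := sub_pos.mpr h.1
    obtain ⟨τ, s, t, s0, s1, t0, t1, m1, m2, tr⟩ := c
    obtain ⟨τ', s', t', s0', s1', t0', t1', m1', m2', tr'⟩ := c'
    simp only at he hp
    subst he
    have tr2 : (p : ℝ) * τ.dir.vec.2 - q * τ.dir.vec.1 ≠ 0 := by exact_mod_cast tr
    have e : (s' - s) * ((p : ℝ) * τ.dir.vec.2 - q * τ.dir.vec.1) = 0 := by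
      linear_combination p * (m2' - m2) - q * (m1' - m1)
    have es : s' = s := by
      rcases mul_eq_zero.mp e with e | e
      · linarith
      · exact absurd e tr2
    subst es
    have e1 : (t' - t) * (p : ℝ) = 0 := by linarith
    have e2 : (t' - t) * (q : ℝ) = 0 := by linarith
    have hp0 : (p : ℝ) = 0 := (mul_eq_zero.mp e1).resolve_left hp.ne'
    have hq0 : (q : ℝ) = 0 := (mul_eq_zero.mp e2).resolve_left hp.ne'
    exact tr2 (by rw [hp0, hq0]; ring)
  intro h'
  cases h with
  | chainDown c i h =>
    generalize hx : (⟨c, i.succ⟩ : Fence k p q) = x at h'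
    generalize hy : (⟨c, i.castSucc⟩ : Fence k p q) = y at h'
    cases h' with
    | chainDown c' j h' =>
      simp only [Fence.mk.injEq, Fin.ext_iff, Fin.val_castSucc, Fin.val_succ] at hx hy
      omega
    | chainUp c' j h' =>
      simp only [Fence.mk.injEq] at hx
      exact h' (hx.1 ▸ h)
    | linkDown c₁ c₂ v hh _ _ _ =>
      simp only [Fence.mk.injEq] at hx hy
      exact hh.1.ne (by rw [← hx.1, ← hy.1])
    | linkUp c₁ c₂ v hh _ _ _ =>
      simp only [Fence.mk.injEq] at hx hy
      exact hh.1.ne (by rw [← hx.1, ← hy.1])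
  | chainUp c i h =>
    generalize hx : (⟨c, i.castSucc⟩ : Fence k p q) = x at h'
    generalize hy : (⟨c, i.succ⟩ : Fence k p q) = y at h'
    cases h' with
    | chainDown c' j h' =>
      simp only [Fence.mk.injEq] at hx
      exact h (hx.1 ▸ h')
    | chainUp c' j h' =>
      simp only [Fence.mk.injEq, Fin.ext_iff, Fin.val_castSucc, Fin.val_succ] at hx hy
      omega
    | linkDown c₁ c₂ v hh _ _ _ =>
      simp only [Fence.mk.injEq] at hx hy
      exact hh.1.ne (by rw [← hx.1, ← hy.1])
    | linkUp c₁ c₂ v hh _ _ _ =>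
      simp only [Fence.mk.injEq] at hx hy
      exact hh.1.ne (by rw [← hx.1, ← hy.1])
  | linkDown c c' v h hc hc' hv =>
    generalize hx : (⟨c', 0⟩ : Fence k p q) = x at h'
    generalize hy : (⟨c, Fin.last k⟩ : Fence k p q) = y at h'
    cases h' with
    | chainDown d j _ =>
      simp only [Fence.mk.injEq] at hx hy
      exact h.1.ne (by rw [hx.1, hy.1])
    | chainUp d j _ =>
      simp only [Fence.mk.injEq] at hx hy
      exact h.1.ne (by rw [hx.1, hy.1])
    | linkDown c₁ c₂ w hh _ _ _ =>
      simp only [Fence.mk.injEq] at hx hy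
      rw [← hx.1, ← hy.1] at hh
      exact lt_asymm h.1 hh.1
    | linkUp c₁ c₂ w hh h1 h2 h3 =>
      simp only [Fence.mk.injEq] at hx hy
      rw [← hy.1] at h1
      rw [← hx.1] at h2
      exact hlink c c' v w h hc hc' hv h1 h2 h3
  | linkUp c c' v h hc hc' hv =>
    generalize hx : (⟨c, Fin.last k⟩ : Fence k p q) = x at h'
    generalize hy : (⟨c', 0⟩ : Fence k p q) = y at h'
    cases h' with
    | chainDown d j _ =>
      simp only [Fence.mk.injEq] at hx hy
      exact h.1.ne (by rw [hx.1, hy.1])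
    | chainUp d j _ =>
      simp only [Fence.mk.injEq] at hx hy
      exact h.1.ne (by rw [hx.1, hy.1])
    | linkUp c₁ c₂ w hh _ _ _ =>
      simp only [Fence.mk.injEq] at hx hy
      rw [← hx.1, ← hy.1] at hh
      exact lt_asymm h.1 hh.1
    | linkDown c₁ c₂ w hh h1 h2 h3 =>
      simp only [Fence.mk.injEq] at hx hy
      rw [← hx.1] at h1
      rw [← hy.1] at h2
      exact hlink c c' w v h h1 h2 h3 hc hc' hv

/-- The fence poset of the segment from `(0,0)` to `(p,q)`; for coprime `p`, `q` it is
`𝓟_{(p,q)}`. Its order is the reflexive transitive closure of the generating relations. -/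
instance instPartialOrder (k : ℕ) (p q : ℤ) : PartialOrder (Fence k p q) where
  le := Relation.ReflTransGen Step
  le_refl _ := Relation.ReflTransGen.refl
  le_trans _ _ _ h h' := Relation.ReflTransGen.trans h h'
  le_antisymm _ _ h h' :=
    antisymm_of_neighbours place place_injective Step Step.neighbours Step.asymm h h'

/-- `x` is the first element of the fence, in the reading along `γ` from `(0,0)` to `(p,q)`. -/
def IsFirst {k : ℕ} {p q : ℤ} (x : Fence k p q) : Prop :=
  x.level = 0 ∧ ∀ d : Crossing p q, x.crossing.t ≤ d.t

/-- `x` is the last element of the fence, in the reading along `γ` from `(0,0)` to `(p,q)`. -/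
def IsLast {k : ℕ} {p q : ℤ} (x : Fence k p q) : Prop :=
  x.level = Fin.last k ∧ ∀ d : Crossing p q, d.t ≤ x.crossing.t

end Fence

/-- For coprime `p`, `q`: the number `m^{(k)}_{(p,q)}` of order ideals of `𝓟_{(p,q)}`. -/
noncomputable def markov (k : ℕ) (p q : ℤ) : ℕ := Nat.card (LowerSet (Fence k p q))

/-- The underlying set of the circular poset `𝓟°_{(p,q)}`: a chain `H(0), …, H(3k+2)` of `3k+3`
new elements, followed by the elements of the fence poset. -/
inductive Circular (k : ℕ) (p q : ℤ)
  | chain (i : Fin (3 * k + 3))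
  | fence (x : Fence k p q)

namespace Circular

/-- The generating relations `x ≺ y` of the circular poset: those of the fence poset, the chain
`H(0) ≻ H(1) ≻ ⋯ ≻ H(3k+2)`, the relation `H(3k+2) ≺ first element of the fence`, and the relation
`last element of the fence ≺ H(0)`. -/
inductive Step {k : ℕ} {p q : ℤ} : Circular k p q → Circular k p q → Prop
  | fence (x y : Fence k p q) (h : x ≤ y) : Step (.fence x) (.fence y)
  | chain (i : Fin (3 * k + 2)) : Step (.chain i.succ) (.chain i.castSucc)
  | toFirst (x : Fence k p q) (h : x.IsFirst) : Step (.chain (Fin.last (3 * k + 2))) (.fence x)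
  | fromLast (x : Fence k p q) (h : x.IsLast) : Step (.fence x) (.chain 0)

/-- An explicit relation containing the closure of the generating relations; it is used only to
show that the closure is antisymmetric. -/
def Bound {k : ℕ} {p q : ℤ} : Circular k p q → Circular k p q → Prop
  | .chain i, .chain j => j ≤ i
  | .chain i, .fence _ => i = Fin.last (3 * k + 2)
  | .fence _, .chain j => j = 0
  | .fence x, .fence y => x ≤ y

theorem bound_of_closure {k : ℕ} {p q : ℤ} {x y : Circular k p q}
    (h : Relation.ReflTransGen Step x y) : Bound x y := by
  induction h with
  | refl => cases x <;> exact le_rfl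
  | @tail b c _ hbc ih =>
    cases hbc with
    | fence u v h =>
      cases x with
      | chain i => exact ih
      | fence w => exact le_trans (show w ≤ u from ih) h
    | chain i =>
      cases x with
      | chain j => exact le_trans Fin.castSucc_lt_succ.le (show i.succ ≤ j from ih)
      | fence w => exact absurd (show i.succ = 0 from ih) (Fin.succ_ne_zero i)
    | toFirst u h =>
      cases x with
      | chain j => exact le_antisymm (Fin.le_last j) ih
      | fence w =>
        have h0 : Fin.last (3 * k + 2) = 0 := ih
        simp [Fin.ext_iff] at h0
    | fromLast u h =>
      cases x with
      | chain j => exact Fin.zero_le j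
      | fence w => exact rfl

/-- The circular poset `𝓟°_{(p,q)}` (for coprime `p`, `q`). -/
instance instPartialOrder (k : ℕ) (p q : ℤ) : PartialOrder (Circular k p q) where
  le := Relation.ReflTransGen Step
  le_refl _ := Relation.ReflTransGen.refl
  le_trans _ _ _ h h' := Relation.ReflTransGen.trans h h'
  le_antisymm x y h h' := by
    have h1 := bound_of_closure h
    have h2 := bound_of_closure h'
    cases x with
    | chain i =>
      cases y with
      | chain j => exact congrArg _ (le_antisymm (show i ≤ j from h2) (show j ≤ i from h1))
      | fence w =>
        have h3 : i = Fin.last (3 * k + 2) := h1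
        have h4 : i = 0 := h2
        rw [h3] at h4
        simp [Fin.ext_iff] at h4
    | fence u =>
      cases y with
      | chain j =>
        have h3 : j = 0 := h1
        have h4 : j = Fin.last (3 * k + 2) := h2
        rw [h3] at h4
        simp [Fin.ext_iff] at h4
      | fence w => exact congrArg _ (le_antisymm (show u ≤ w from h1) (show w ≤ u from h2))

end Circular

end KMarkov

/-! A lower set of `𝓟°` consists of an ideal `I` of the fence and a final segment of the chain of
`3k + 3` elements, of which there are `3k + 4`. The relations at the ends forbid the empty segment
when `I` contains the first element of the fence, and the full one when `I` does not contain the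
last. With `m` ideals in the fence, `A` of which contain the first element and `B` the last one,
this leaves `(3k + 4) m - A - (m - B) = (3k + 3) m - (A - B)`.

The numbers `A` and `B` are read off a product of `2 × 2` transfer matrices of determinant `1`, one
for each pair of neighbours, and `A - B` is the difference of its off-diagonal entries. The half
turn about the midpoint of `γ` reverses the fence and exchanges rises and falls, except that the
midpoint itself is a crossing, at the middle of its line segment, so that its `k` rises stay rises.
A fall has the transpose of the transfer matrix `T` of a rise, so the product has the form
`X * T ^ k * Xᵀ`, and its off-diagonal entries differ by `k * det X = k`.
-/

namespace KMarkov

open Matrix Relation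

theorem sum_paths_eq_dotProduct {ι R : Type*} [Fintype ι] [DecidableEq ι] [CommSemiring R] {n : ℕ}
    (M : Fin n → Matrix ι ι R) (f g : ι → R) :
    ∑ s : Fin (n + 1) → ι, f (s 0) * (∏ l, M l (s l.castSucc) (s l.succ)) * g (s (Fin.last n)) =
      f ⬝ᵥ (List.ofFn M).prod *ᵥ g := by
  induction n generalizing f with
  | zero =>
    rw [← (Equiv.funUnique (Fin 1) ι).symm.sum_comp]
    simp [dotProduct]
  | succ n ih =>
    calc
      _ = ∑ s : Fin (n + 1) → ι, ∑ x, f x * (M 0 x (s 0) *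
            ∏ l : Fin n, M l.succ (s l.castSucc) (s l.succ)) * g (s (Fin.last n)) := by
        rw [← (Fin.consEquiv fun _ => ι).sum_comp, Fintype.sum_prod_type_right]
        simp [Fin.prod_univ_succ, ← Fin.succ_last, ← Fin.succ_castSucc, -Fin.castSucc_succ]
      _ = ∑ s : Fin (n + 1) → ι, (f ᵥ* M 0) (s 0) *
            (∏ l : Fin n, M l.succ (s l.castSucc) (s l.succ)) * g (s (Fin.last n)) := by
        simp only [vecMul, dotProduct, Finset.sum_mul, mul_assoc]
      _ = f ⬝ᵥ (List.ofFn M).prod *ᵥ g := by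
        rw [ih, List.ofFn_succ, List.prod_cons, ← mulVec_mulVec, dotProduct_mulVec f]

theorem mul_mul_transpose_apply_sub_apply {R : Type*} [CommRing R]
    (X K : Matrix (Fin 2) (Fin 2) R) :
    (X * K * Xᵀ) 1 0 - (X * K * Xᵀ) 0 1 = X.det * (K 1 0 - K 0 1) := by
  simp only [mul_apply, transpose_apply, Fin.sum_univ_two, det_fin_two]
  ring

/-- The transfer matrix of one relation of a fence: the rows are indexed by the membership
(`1` for a member) of an element in an order ideal, the columns by that of its right neighbour, and
the entry says whether the two are compatible. The letter `true` stands for a rise, that is,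
for a right neighbour which is the larger element. -/
def transfer : Bool → Matrix (Fin 2) (Fin 2) ℤ
  | true => !![1, 0; 1, 1]
  | false => !![1, 1; 0, 1]

theorem transfer_apply (b : Bool) (x y : Fin 2) :
    transfer b x y = if (b = true → y ≤ x) ∧ (b = false → x ≤ y) then 1 else 0 := by
  cases b <;> fin_cases x <;> fin_cases y <;> simp [transfer]

theorem transfer_not (b : Bool) : transfer (!b) = (transfer b)ᵀ := by
  revert b
  decide

theorem det_transfer (b : Bool) : (transfer b).det = 1 := by
  cases b <;> simp [transfer]

theorem transfer_true_pow (k : ℕ) : transfer true ^ k = !![1, 0; (k : ℤ), 1] := by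
  induction k with
  | zero => simp [one_fin_two]
  | succ k ih =>
    rw [pow_succ, ih]
    simp [transfer]

theorem det_prod_transfer (w : List Bool) : (w.map transfer).prod.det = 1 := by
  induction w with
  | nil => simp
  | cons b w ih => simp [det_transfer, ih]

theorem prod_transfer_reverse_map_not (w : List Bool) :
    ((w.map not).reverse.map transfer).prod = (w.map transfer).prodᵀ := by
  simp [transpose_list_prod, Function.comp_def, transfer_not]

theorem prod_transfer_apply_sub_apply (u : List Bool) (k : ℕ) :
    ((u ++ List.replicate k true ++ (u.map not).reverse).map transfer).prod 1 0 -
      ((u ++ List.replicate k true ++ (u.map not).reverse).map transfer).prod 0 1 = k := by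
  have factorization : ((u ++ List.replicate k true ++ (u.map not).reverse).map transfer).prod =
      (u.map transfer).prod * transfer true ^ k * (u.map transfer).prodᵀ := by
    rw [List.map_append, List.map_append, List.prod_append, List.prod_append,
      prod_transfer_reverse_map_not, List.map_replicate, List.prod_replicate]
  rw [factorization, mul_mul_transpose_apply_sub_apply, det_prod_transfer, transfer_true_pow]
  simp

theorem ofFn_eq_append_replicate_append {a k n : ℕ} (hn : n = 2 * a + k) {r : Fin n → Bool}
    (hmid : ∀ l : Fin n, a ≤ l → l < a + k → r l = true)
    (hrev : ∀ l : Fin n, l < a → r l.rev = !r l) :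
    ∃ u, List.ofFn r = u ++ List.replicate k true ++ (u.map not).reverse := by
  have ha : a ≤ n := by omega
  refine ⟨List.ofFn fun i : Fin a => r (i.castLE ha), List.ext_getElem (by simp; omega) ?_⟩
  intro i hi _
  simp only [List.length_ofFn] at hi
  rcases lt_or_ge i a with hleft | hleft
  · simp [hleft]
  rcases lt_or_ge i (a + k) with hright | hright
  · have hmem : i - a < k := by omega
    simpa [List.getElem_append, hleft.not_gt, hright, hmem] using hmid ⟨i, hi⟩ hleft hright
  · have h := hrev (Fin.rev ⟨i, hi⟩) (by simp only [Fin.val_rev]; omega)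
    rw [Fin.rev_rev] at h
    simp only [List.getElem_ofFn, List.getElem_append, List.length_append, List.length_ofFn,
      List.length_replicate, hright.not_gt, dite_false, List.getElem_reverse, List.getElem_map,
      List.length_map, h]
    congr 2
    ext
    simp only [Fin.val_rev, Fin.val_castLE]
    omega

theorem isLowerSet_iff_of_le_iff_reflTransGen {α : Type*} [LE α] {R : α → α → Prop}
    (hle : ∀ x y : α, x ≤ y ↔ ReflTransGen R x y) {S : Set α} :
    IsLowerSet S ↔ ∀ x y, R x y → y ∈ S → x ∈ S := by
  refine ⟨fun h x y hxy => h ((hle x y).2 (.single hxy)), fun h y x hxy hy => ?_⟩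
  induction (hle x y).1 hxy using ReflTransGen.head_induction_on with
  | refl => exact hy
  | head hab hby ih => exact h _ _ hab (ih ((hle _ _).2 hby))

/-- The generating relations `i ≺ j` of the fence on `0, …, n` whose shape is the word `r`: the
letter `r l` says whether there is a rise or a fall from `l` to `l + 1`. -/
inductive FenceStep {n : ℕ} (r : Fin n → Bool) : Fin (n + 1) → Fin (n + 1) → Prop
  | rise (l : Fin n) (h : r l = true) : FenceStep r l.castSucc l.succ
  | fall (l : Fin n) (h : r l = false) : FenceStep r l.succ l.castSucc

section FencePoset

variable {α : Type*} [LE α] {R : α → α → Prop} {n : ℕ} {e : Fin (n + 1) ≃ α} {r : Fin n → Bool}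

theorem isLowerSet_iff_of_iff_fenceStep (hle : ∀ x y : α, x ≤ y ↔ ReflTransGen R x y)
    (hR : ∀ i j, R (e i) (e j) ↔ FenceStep r i j) {S : Set α} :
    IsLowerSet S ↔ ∀ l : Fin n, (r l = true → e l.succ ∈ S → e l.castSucc ∈ S) ∧
      (r l = false → e l.castSucc ∈ S → e l.succ ∈ S) := by
  simp only [isLowerSet_iff_of_le_iff_reflTransGen hle, ← e.forall_congr_right, hR]
  refine ⟨fun h l => ⟨fun hl => h _ _ (.rise l hl), fun hl => h _ _ (.fall l hl)⟩, ?_⟩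
  rintro h _ _ (⟨l, hl⟩ | ⟨l, hl⟩)
  · exact (h l).1 hl
  · exact (h l).2 hl

theorem card_lowerSet_mem_eq_sum (hle : ∀ x y : α, x ≤ y ↔ ReflTransGen R x y)
    (hR : ∀ i j, R (e i) (e j) ↔ FenceStep r i j) (j : Fin (n + 1)) :
    (Nat.card {I : LowerSet α // e j ∈ I} : ℤ) = ∑ s : Fin (n + 1) → Fin 2,
      (∏ l, transfer (r l) (s l.castSucc) (s l.succ)) * if s j = 1 then 1 else 0 := by
  classical
  have one_le : ∀ x y : Fin 2, x ≤ y ↔ (x = 1 → y = 1) := by decide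
  have ideals_equiv : {I : LowerSet α // e j ∈ I} ≃ {s : Fin (n + 1) → Fin 2 //
      (∀ l : Fin n, (r l = true → s l.succ ≤ s l.castSucc) ∧
        (r l = false → s l.castSucc ≤ s l.succ)) ∧ s j = 1} :=
    { toFun I := ⟨fun i => if e i ∈ I.1 then 1 else 0, by
        simpa [one_le, I.2] using (isLowerSet_iff_of_iff_fenceStep hle hR).1 I.1.lower⟩
      invFun s := ⟨⟨{x | s.1 (e.symm x) = 1}, (isLowerSet_iff_of_iff_fenceStep hle hR).2 <| by
        simpa [one_le] using s.2.1⟩, by simpa using s.2.2⟩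
      left_inv I := by ext; simp
      right_inv s := by
        ext i : 2
        have : ∀ x : Fin 2, (if x = 1 then 1 else 0) = x := by decide
        simp [this] }
  rw [Nat.card_congr ideals_equiv, Nat.card_eq_fintype_card, Fintype.card_subtype,
    Finset.card_filter]
  simp only [transfer_apply, Finset.prod_boole, Finset.mem_univ, true_implies, ← ite_and,
    Nat.cast_sum, Nat.cast_ite, Nat.cast_one, Nat.cast_zero, mul_ite, mul_one, mul_zero]
  simp only [and_comm]

theorem card_lowerSet_mem_first_sub_last (hle : ∀ x y : α, x ≤ y ↔ ReflTransGen R x y)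
    (hR : ∀ i j, R (e i) (e j) ↔ FenceStep r i j) {u : List Bool} {k : ℕ}
    (hr : List.ofFn r = u ++ List.replicate k true ++ (u.map not).reverse) :
    (Nat.card {I : LowerSet α // e 0 ∈ I} : ℤ) -
      Nat.card {I : LowerSet α // e (Fin.last n) ∈ I} = k := by
  have hfirst : (Nat.card {I : LowerSet α // e 0 ∈ I} : ℤ) =
      Pi.single 1 1 ⬝ᵥ ((List.ofFn r).map transfer).prod *ᵥ 1 := by
    rw [card_lowerSet_mem_eq_sum hle hR, List.map_ofFn, ← sum_paths_eq_dotProduct]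
    simp [Pi.single_apply]
  have hlast : (Nat.card {I : LowerSet α // e (Fin.last n) ∈ I} : ℤ) =
      1 ⬝ᵥ ((List.ofFn r).map transfer).prod *ᵥ Pi.single 1 1 := by
    rw [card_lowerSet_mem_eq_sum hle hR, List.map_ofFn, ← sum_paths_eq_dotProduct]
    simp [Pi.single_apply]
  rw [hfirst, hlast, ← prod_transfer_apply_sub_apply u k, hr]
  simp [mulVec, dotProduct, Fin.sum_univ_two]

end FencePoset

theorem exists_intCast_eq_of_isCoprime {R : Type*} [CommRing R] {p q a b : ℤ} {t : R}
    (hpq : IsCoprime p q) (ha : t * p = a) (hb : t * q = b) : ∃ n : ℤ, t = n := by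
  obtain ⟨u, v, huv⟩ := hpq
  have huv' : (u : R) * p + v * q = 1 := by exact_mod_cast congrArg (Int.cast (R := R)) huv
  refine ⟨u * a + v * b, ?_⟩
  push_cast
  linear_combination (-t) * huv' + u * ha + v * hb

theorem exists_int_mapsTo_Icc {f : ℝ → ℝ} {x y : ℝ} (hxy : x < y) (hf : Continuous f)
    (hne : ∀ t ∈ Set.Ioo x y, ∀ z : ℤ, f t ≠ z) :
    ∃ a : ℤ, Set.MapsTo f (Set.Icc x y) (Set.Icc (a : ℝ) (a + 1)) := by
  obtain ⟨m, hxm, hmy⟩ := exists_between hxy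
  have not_crossed : ∀ t ∈ Set.Icc x y, ∀ z : ℤ, (z : ℝ) ∈ Set.uIcc (f t) (f m) → f t = z := by
    intro t ht z hz
    obtain ⟨t', ht', hft'⟩ := intermediate_value_uIcc hf.continuousOn hz
    by_contra hftz
    have htt' : t' ≠ t := by rintro rfl; exact hftz hft'
    refine hne t' ?_ z hft'
    rcases Set.mem_uIcc.1 ht' with h | h
    · exact ⟨ht.1.trans_lt (lt_of_le_of_ne h.1 htt'.symm), h.2.trans_lt hmy⟩
    · exact ⟨hxm.trans_le h.1, (lt_of_le_of_ne h.2 htt').trans_le ht.2⟩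
  refine ⟨⌊f m⌋, fun t ht => ⟨?_, ?_⟩⟩
  · by_contra! hlt
    exact hlt.ne (not_crossed t ht _ (Set.mem_uIcc.2 (.inl ⟨hlt.le, Int.floor_le _⟩)))
  · by_contra! hlt
    refine hlt.ne' ?_
    exact_mod_cast not_crossed t ht (⌊f m⌋ + 1) (Set.mem_uIcc.2 (.inr
      ⟨by exact_mod_cast (Int.lt_floor_add_one (f m)).le, by exact_mod_cast hlt.le⟩))

theorem mem_Icc_of_add_mul_mem_Icc {a m n : ℤ} {s : ℝ} (hs₀ : 0 < s) (hs₁ : s < 1)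
    (hn : n ∈ Set.Icc (-1) 1) (h : m + s * n ∈ Set.Icc (a : ℝ) (a + 1)) :
    m ∈ Set.Icc a (a + 1) ∧ m + n ∈ Set.Icc a (a + 1) := by
  obtain ⟨h₁, h₂⟩ := h
  have hn' : n = -1 ∨ n = 0 ∨ n = 1 := by
    have := hn.1
    have := hn.2
    omega
  rcases hn' with rfl | rfl | rfl <;> push_cast at h₁ h₂
  · have : (a : ℝ) < m := by linarith
    have : (m : ℝ) < a + 2 := by linarith
    norm_cast at *
    simp only [Set.mem_Icc]
    omega
  · rw [mul_zero, add_zero] at h₁ h₂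
    rw [add_zero]
    exact ⟨⟨by exact_mod_cast h₁, by exact_mod_cast h₂⟩, by exact_mod_cast h₁, by exact_mod_cast h₂⟩
  · have : (a : ℝ) < m + 1 := by linarith
    have : (m : ℝ) < a + 1 := by linarith
    norm_cast at *
    simp only [Set.mem_Icc]
    omega

instance : Finite Dir :=
  Finite.of_surjective ![Dir.horizontal, .vertical, .diagonal]
    fun d => by cases d; exacts [⟨0, rfl⟩, ⟨1, rfl⟩, ⟨2, rfl⟩]

theorem Dir.forall {P : Dir → Prop} : (∀ d, P d) ↔ P horizontal ∧ P vertical ∧ P diagonal :=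
  ⟨fun h => ⟨h _, h _, h _⟩, fun h d => by cases d; exacts [h.1, h.2.1, h.2.2]⟩

/-- The linear form with kernel the line of direction `d` through the origin: the lines of `𝓛` of
direction `d` are its level sets at the integers. -/
def Dir.level : Dir → ℤ × ℤ → ℤ
  | .horizontal, v => v.2
  | .vertical, v => v.1
  | .diagonal, v => v.1 + v.2

theorem Dir.level_add (d : Dir) (v w : ℤ × ℤ) : d.level (v + w) = d.level v + d.level w := by
  cases d <;> simp only [Dir.level, Prod.fst_add, Prod.snd_add]
  ring

theorem Dir.level_vec_self (d : Dir) : d.level d.vec = 0 := by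
  cases d <;> rfl

theorem Dir.level_vec_mem_Icc (d d' : Dir) : d.level d'.vec ∈ Set.Icc (-1) 1 := by
  cases d <;> cases d' <;> simp [Dir.level, Dir.vec]

theorem Dir.abs_level_le (d : Dir) (v : ℤ × ℤ) : |d.level v| ≤ |v.1| + |v.2| := by
  cases d
  · exact le_add_of_nonneg_left (abs_nonneg _)
  · exact le_add_of_nonneg_right (abs_nonneg _)
  · exact abs_add_le _ _

theorem Dir.cross_vec_ne_zero_iff {p q : ℤ} (d : Dir) :
    p * d.vec.2 - q * d.vec.1 ≠ 0 ↔ d.level (p, q) ≠ 0 := by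
  cases d <;> simp [Dir.vec, Dir.level]

theorem Dir.exists_even_level (v : ℤ × ℤ) : ∃ d : Dir, Even (d.level v) := by
  by_cases h₁ : Even v.1
  · exact ⟨.vertical, h₁⟩
  by_cases h₂ : Even v.2
  · exact ⟨.horizontal, h₂⟩
  · exact ⟨.diagonal, (Int.not_even_iff_odd.1 h₁).add_odd (Int.not_even_iff_odd.1 h₂)⟩

-- The three strips meet in a triangle cut out by the lines of `𝓛`, in a point or not at all, and
-- any two sides of a triangle share a vertex.
theorem Edge.exists_common_endpoint {τ τ' : Edge} {a : Dir → ℤ}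
    (hτ : ∀ v, τ.IsEndpoint v → ∀ d, d.level v ∈ Set.Icc (a d) (a d + 1))
    (hτ' : ∀ v, τ'.IsEndpoint v → ∀ d, d.level v ∈ Set.Icc (a d) (a d + 1)) :
    ∃ v, τ.IsEndpoint v ∧ τ'.IsEndpoint v := by
  obtain ⟨⟨x, y⟩, d⟩ := τ
  obtain ⟨⟨x', y'⟩, d'⟩ := τ'
  simp only [Edge.IsEndpoint, forall_eq_or_imp, forall_eq, Dir.forall, Set.mem_Icc] at hτ hτ'
  by_contra! hdisjoint
  simp only [Edge.IsEndpoint, forall_eq_or_imp, forall_eq, not_or] at hdisjoint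
  cases d <;> cases d' <;>
    simp only [Edge.tgt, Dir.vec, Dir.level, Prod.mk_add_mk, Prod.mk.injEq] at hτ hτ' hdisjoint <;>
    omega

theorem leftOf_sub {p q : ℤ} {v : ℤ × ℤ} : LeftOf p q ((p, q) - v) ↔ RightOf p q v := by
  simp only [LeftOf, RightOf, Prod.fst_sub, Prod.snd_sub]
  constructor <;> intro h <;> linarith

theorem rightOf_sub {p q : ℤ} {v : ℤ × ℤ} : RightOf p q ((p, q) - v) ↔ LeftOf p q v := by
  simp only [LeftOf, RightOf, Prod.fst_sub, Prod.snd_sub]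
  constructor <;> intro h <;> linarith

namespace Crossing

variable {p q : ℤ}

theorem t_mul_level (c : Crossing p q) (d : Dir) :
    c.t * (d.level (p, q) : ℝ) = d.level c.edge.src + c.s * d.level c.edge.dir.vec := by
  cases d <;> simp only [Dir.level, Int.cast_add]
  · exact c.meet_snd.symm
  · exact c.meet_fst.symm
  · linear_combination -c.meet_fst - c.meet_snd

theorem t_mul_level_dir (c : Crossing p q) :
    c.t * (c.edge.dir.level (p, q) : ℝ) = c.edge.dir.level c.edge.src := by
  simp [t_mul_level, Dir.level_vec_self]

theorem level_dir_ne_zero (c : Crossing p q) : c.edge.dir.level (p, q) ≠ 0 :=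
  (Dir.cross_vec_ne_zero_iff _).1 c.transversal

theorem abs_level_src_le (c : Crossing p q) :
    |c.edge.dir.level c.edge.src| ≤ |p| + |q| := by
  have h : |(c.edge.dir.level c.edge.src : ℝ)| ≤ |(c.edge.dir.level (p, q) : ℝ)| := by
    rw [← t_mul_level_dir, abs_mul, abs_of_pos c.t_pos]
    exact mul_le_of_le_one_left (abs_nonneg _) c.t_lt_one.le
  exact (by exact_mod_cast h : _ ≤ |c.edge.dir.level (p, q)|).trans (Dir.abs_level_le _ _)

instance : Finite (Crossing p q) := by
  refine Finite.of_injective (β := Dir × Set.Icc (-(|p| + |q|)) (|p| + |q|))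
    (fun c => (c.edge.dir, ⟨_, abs_le.1 c.abs_level_src_le⟩)) fun c c' h => t_injective ?_
  obtain ⟨hdir, hlevel⟩ := Prod.mk.inj h
  have hlevel := Subtype.mk.inj hlevel
  refine mul_right_cancel₀ (Int.cast_ne_zero.2 c.level_dir_ne_zero) ?_
  rw [t_mul_level_dir, hlevel, hdir, t_mul_level_dir]

theorem exists_t_eq_of_mem_line (hpq : IsCoprime p q) {t : ℝ} (ht : t ∈ Set.Ioo 0 1) {d : Dir}
    (hd : d.level (p, q) ≠ 0) {v : ℤ × ℤ} {x : ℝ} (h₁ : v.1 + x * d.vec.1 = t * p)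
    (h₂ : v.2 + x * d.vec.2 = t * q) : ∃ c : Crossing p q, c.t = t := by
  have not_integral : ∀ n : ℤ, x ≠ n := by
    rintro n rfl
    obtain ⟨m, rfl⟩ := exists_intCast_eq_of_isCoprime (R := ℝ) hpq
      (by exact_mod_cast h₁.symm) (by exact_mod_cast h₂.symm)
    obtain ⟨h, h'⟩ := ht
    norm_cast at h h'
    omega
  refine ⟨⟨⟨v + ⌊x⌋ • d.vec, d⟩, Int.fract x, t, Int.fract_pos.2 (not_integral _),
    Int.fract_lt_one x, ht.1, ht.2, ?_, ?_, (Dir.cross_vec_ne_zero_iff d).2 hd⟩, rfl⟩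
  · rw [← h₁, Int.fract]
    push_cast [Prod.fst_add, Prod.smul_fst, smul_eq_mul]
    ring
  · rw [← h₂, Int.fract]
    push_cast [Prod.snd_add, Prod.smul_snd, smul_eq_mul]
    ring

theorem exists_t_eq (hpq : IsCoprime p q) {t : ℝ} (ht : t ∈ Set.Ioo 0 1) {d : Dir}
    (hd : d.level (p, q) ≠ 0) {z : ℤ} (hz : t * d.level (p, q) = z) :
    ∃ c : Crossing p q, c.t = t := by
  cases d <;> simp only [Dir.level] at hz
  · exact exists_t_eq_of_mem_line hpq ht hd (v := (0, z)) (x := t * p)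
      (by simp [Dir.vec]) (by simp [Dir.vec, hz])
  · exact exists_t_eq_of_mem_line hpq ht hd (v := (z, 0)) (x := t * q)
      (by simp [Dir.vec, hz]) (by simp [Dir.vec])
  · exact exists_t_eq_of_mem_line hpq ht hd (v := (z, 0)) (x := t * q)
      (by simp [Dir.vec, ← hz, mul_add]) (by simp [Dir.vec])

theorem Consecutive.exists_strip (hpq : IsCoprime p q) {d : Dir} (hd : d.level (p, q) ≠ 0)
    {c c' : Crossing p q} (h : c.Consecutive c') :
    ∃ a : ℤ, c.t * d.level (p, q) ∈ Set.Icc (a : ℝ) (a + 1) ∧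
      c'.t * d.level (p, q) ∈ Set.Icc (a : ℝ) (a + 1) := by
  obtain ⟨a, ha⟩ := exists_int_mapsTo_Icc h.1 (continuous_mul_const (d.level (p, q) : ℝ)) <| by
    intro t ht z hz
    obtain ⟨c'', rfl⟩ := exists_t_eq hpq ⟨c.t_pos.trans ht.1, ht.2.trans c'.t_lt_one⟩ hd hz
    exact h.2 c'' ht
  exact ⟨a, ha (Set.left_mem_Icc.2 h.1.le), ha (Set.right_mem_Icc.2 h.1.le)⟩

theorem level_mem_Icc_of_isEndpoint (c : Crossing p q) {d : Dir} {a : ℤ}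
    (h : c.t * d.level (p, q) ∈ Set.Icc (a : ℝ) (a + 1)) {v : ℤ × ℤ} (hv : c.edge.IsEndpoint v) :
    d.level v ∈ Set.Icc a (a + 1) := by
  rw [t_mul_level] at h
  have endpoints_mem := mem_Icc_of_add_mul_mem_Icc c.s_pos c.s_lt_one (d.level_vec_mem_Icc _) h
  rcases hv with rfl | rfl
  · exact endpoints_mem.1
  · rw [Edge.tgt, Dir.level_add]
    exact endpoints_mem.2

theorem Consecutive.exists_common_endpoint (hpq : IsCoprime p q)
    (hγ : ∀ d : Dir, d.level (p, q) ≠ 0) {c c' : Crossing p q} (h : c.Consecutive c') :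
    ∃ v, c.edge.IsEndpoint v ∧ c'.edge.IsEndpoint v := by
  choose a ha ha' using fun d => h.exists_strip hpq (hγ d)
  exact Edge.exists_common_endpoint (fun _ hv d => c.level_mem_Icc_of_isEndpoint (ha d) hv)
    fun _ hv d => c'.level_mem_Icc_of_isEndpoint (ha' d) hv

theorem cross_src (c : Crossing p q) : ((p * c.edge.src.2 - q * c.edge.src.1 : ℤ) : ℝ) =
    -(c.s * ((p * c.edge.dir.vec.2 - q * c.edge.dir.vec.1 : ℤ) : ℝ)) := by
  push_cast
  linear_combination p * c.meet_snd - q * c.meet_fst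

theorem cross_tgt (c : Crossing p q) : ((p * c.edge.tgt.2 - q * c.edge.tgt.1 : ℤ) : ℝ) =
    (1 - c.s) * ((p * c.edge.dir.vec.2 - q * c.edge.dir.vec.1 : ℤ) : ℝ) := by
  simp only [Edge.tgt, Prod.fst_add, Prod.snd_add]
  push_cast
  linear_combination p * c.meet_snd - q * c.meet_fst

theorem rightOf_src (c : Crossing p q) :
    RightOf p q c.edge.src ↔ 0 < p * c.edge.dir.vec.2 - q * c.edge.dir.vec.1 := by
  rw [RightOf, ← Int.cast_lt (R := ℝ), cross_src, Int.cast_zero, neg_lt_zero,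
    mul_pos_iff_of_pos_left c.s_pos, Int.cast_pos]

theorem rightOf_tgt (c : Crossing p q) :
    RightOf p q c.edge.tgt ↔ p * c.edge.dir.vec.2 - q * c.edge.dir.vec.1 < 0 := by
  rw [RightOf, ← Int.cast_lt (R := ℝ), cross_tgt, Int.cast_zero,
    ← smul_eq_mul, smul_neg_iff_of_pos_left (sub_pos.2 c.s_lt_one), Int.cast_lt_zero]

theorem rightOf_or_leftOf (c : Crossing p q) {v : ℤ × ℤ} (hv : c.edge.IsEndpoint v) :
    RightOf p q v ∨ LeftOf p q v := by
  have htr : ((p * c.edge.dir.vec.2 - q * c.edge.dir.vec.1 : ℤ) : ℝ) ≠ 0 :=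
    Int.cast_ne_zero.2 c.transversal
  refine lt_or_gt_of_ne (Int.cast_ne_zero (α := ℝ).1 ?_)
  rcases hv with rfl | rfl
  · rw [cross_src]
    exact neg_ne_zero.2 (mul_ne_zero c.s_pos.ne' htr)
  · rw [cross_tgt]
    exact mul_ne_zero (sub_pos.2 c.s_lt_one).ne' htr

theorem closerToRight_iff (c : Crossing p q) : c.CloserToRight ↔
    0 < (1 / 2 - c.s) * ((p * c.edge.dir.vec.2 - q * c.edge.dir.vec.1 : ℤ) : ℝ) := by
  rw [CloserToRight, rightOf_src, rightOf_tgt, mul_comm (1 / 2 - c.s), mul_pos_iff, Int.cast_pos,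
    Int.cast_lt_zero, sub_pos (b := c.s), sub_neg (b := c.s)]

/-- The half turn about the midpoint of `γ`. It exchanges the endpoints of a line segment, so that
the crossed one is parametrized anew from the image of its target. -/
@[simps]
def rotate (c : Crossing p q) : Crossing p q where
  edge := ⟨(p, q) - c.edge.tgt, c.edge.dir⟩
  s := 1 - c.s
  t := 1 - c.t
  s_pos := sub_pos.2 c.s_lt_one
  s_lt_one := sub_lt_self 1 c.s_pos
  t_pos := sub_pos.2 c.t_lt_one
  t_lt_one := sub_lt_self 1 c.t_pos
  meet_fst := by
    simp only [Edge.tgt, Prod.fst_sub, Prod.fst_add]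
    push_cast
    linear_combination -c.meet_fst
  meet_snd := by
    simp only [Edge.tgt, Prod.snd_sub, Prod.snd_add]
    push_cast
    linear_combination -c.meet_snd
  transversal := c.transversal

theorem rotate_rotate (c : Crossing p q) : c.rotate.rotate = c :=
  t_injective (by simp)

theorem isEndpoint_rotate {c : Crossing p q} {v : ℤ × ℤ} (hv : c.edge.IsEndpoint v) :
    c.rotate.edge.IsEndpoint ((p, q) - v) := by
  rcases hv with rfl | rfl
  · right
    simp only [Edge.tgt, rotate_edge_src, rotate_edge_dir]
    abel
  · exact .inl rfl

theorem Consecutive.rotate {c c' : Crossing p q} (h : c.Consecutive c') :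
    c'.rotate.Consecutive c.rotate := by
  refine ⟨sub_lt_sub_left h.1 1, fun d hd => h.2 d.rotate ?_⟩
  simp only [rotate_t] at hd ⊢
  constructor <;> linarith [hd.1, hd.2]

theorem t_eq_half_of_s_eq_half (hpq : IsCoprime p q) {c : Crossing p q} (h : c.s = 1 / 2) :
    c.t = 1 / 2 := by
  obtain ⟨n, hn⟩ := exists_intCast_eq_of_isCoprime (t := 2 * c.t) hpq
    (a := 2 * c.edge.src.1 + c.edge.dir.vec.1) (b := 2 * c.edge.src.2 + c.edge.dir.vec.2)
    (by push_cast; linear_combination -2 * c.meet_fst + 2 * c.edge.dir.vec.1 * h)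
    (by push_cast; linear_combination -2 * c.meet_snd + 2 * c.edge.dir.vec.2 * h)
  have hn₀ : (0 : ℝ) < n := by linarith [c.t_pos]
  have hn₂ : (n : ℝ) < 2 := by linarith [c.t_lt_one]
  norm_cast at hn₀ hn₂
  obtain rfl : n = 1 := by omega
  rw [Int.cast_one] at hn
  linarith

theorem closerToRight_rotate (hpq : IsCoprime p q) {c : Crossing p q} (h : c.t ≠ 1 / 2) :
    c.rotate.CloserToRight ↔ ¬ c.CloserToRight := by
  have hs : 1 / 2 - c.s ≠ 0 := fun hs => h (t_eq_half_of_s_eq_half hpq (sub_eq_zero.1 hs).symm)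
  have hne := mul_ne_zero hs (Int.cast_ne_zero.2 c.transversal)
  have hrotate : 1 / 2 - (1 - c.s) = -(1 / 2 - c.s) := by ring
  rw [closerToRight_iff, closerToRight_iff, rotate_edge_dir, rotate_s, hrotate, neg_mul, neg_pos,
    not_lt, hne.le_iff_lt]

theorem exists_t_eq_half (hpq : IsCoprime p q) (hγ : ∀ d : Dir, d.level (p, q) ≠ 0) :
    ∃ c : Crossing p q, c.t = 1 / 2 := by
  obtain ⟨d, z, hz⟩ := Dir.exists_even_level (p, q)
  refine exists_t_eq hpq (by norm_num) (hγ d) (z := z) ?_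
  rw [hz]
  push_cast
  ring

theorem rotate_eq_self {c : Crossing p q} (h : c.t = 1 / 2) : c.rotate = c :=
  t_injective (by simp only [rotate_t, h]; norm_num)

theorem not_closerToRight {c : Crossing p q} (h : c.t = 1 / 2) : ¬ c.CloserToRight := by
  have hs : 1 - c.s = c.s := congrArg Crossing.s (rotate_eq_self h)
  rw [closerToRight_iff, show 1 / 2 - c.s = 0 by linarith, zero_mul]
  exact lt_irrefl 0

end Crossing

/-- `y` comes immediately after `x` in the order that is pulled back along `f`. The neighbours in
`Fence.chain_neighbours`, `Fence.link_neighbours` and `Fence.Step.neighbours` are of this form for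
`f = Fence.place`. -/
def NextAlong {α β : Type*} [LT β] (f : α → β) (x y : α) : Prop :=
  f x < f y ∧ ∀ z, ¬ (f x < f z ∧ f z < f y)

section Enumeration

variable {α β : Type*} [LinearOrder β] {f : α → β}

theorem exists_equiv_fin_strictMono [Finite α] [Nonempty α] (hf : Function.Injective f) :
    ∃ (n : ℕ) (e : Fin (n + 1) ≃ α), StrictMono (f ∘ e) := by
  classical
  have := Fintype.ofFinite α
  let : LinearOrder α := LinearOrder.lift' f hf
  obtain ⟨n, hn⟩ := Nat.exists_eq_succ_of_ne_zero (Fintype.card_ne_zero (α := α))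
  exact ⟨n, (monoEquivOfFin α hn).toEquiv, fun _ _ hij => (monoEquivOfFin α hn).strictMono hij⟩

variable {n : ℕ} {e : Fin (n + 1) ≃ α}

theorem nextAlong_iff_val_eq (he : StrictMono (f ∘ e)) {i j : Fin (n + 1)} :
    NextAlong f (e i) (e j) ↔ (j : ℕ) = i + 1 := by
  have hlt : ∀ i j, f (e i) < f (e j) ↔ i < j := fun _ _ => he.lt_iff_lt
  simp only [NextAlong, ← e.forall_congr_right, hlt]
  refine ⟨fun ⟨hij, hnone⟩ => ?_, fun h => ⟨?_, fun l => ?_⟩⟩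
  · have := hnone ⟨i + 1, by omega⟩
    simp only [Fin.lt_def] at this hij
    omega
  · simp only [Fin.lt_def]
    omega
  · simp only [Fin.lt_def]
    omega

theorem apply_rev_eq_of_strictAnti_comp (hf : Function.Injective f) (he : StrictMono (f ∘ e))
    {ρ : α → α} (hρ : Function.Involutive ρ) (hanti : ∀ x y, f x < f y → f (ρ y) < f (ρ x))
    (i : Fin (n + 1)) : e i.rev = ρ (e i) := by
  have hmono : StrictMono fun i : Fin (n + 1) => f (ρ (e i.rev)) := fun i j hij =>
    hanti _ _ (he (Fin.rev_lt_rev.2 hij))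
  have hrange : Set.range (f ∘ e) = Set.range fun i : Fin (n + 1) => f (ρ (e i.rev)) := by
    have hsurj : Function.Surjective fun i : Fin (n + 1) => ρ (e i.rev) :=
      hρ.surjective.comp (e.surjective.comp Fin.rev_surjective)
    rw [e.surjective.range_comp, ← hsurj.range_comp]
    rfl
  simpa using hf (congrFun ((he.range_inj hmono).1 hrange) i.rev)

theorem eq_apply_zero_of_forall_le (hf : Function.Injective f) (he : StrictMono (f ∘ e)) {x : α}
    (hx : ∀ y, f x ≤ f y) : x = e 0 := by
  refine hf (le_antisymm (hx _) ?_)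
  rw [← e.apply_symm_apply x]
  exact he.monotone (Fin.zero_le _)

theorem eq_apply_last_of_forall_le (hf : Function.Injective f) (he : StrictMono (f ∘ e)) {x : α}
    (hx : ∀ y, f y ≤ f x) : x = e (Fin.last n) := by
  refine hf (le_antisymm ?_ (hx _))
  rw [← e.apply_symm_apply x]
  exact he.monotone (Fin.le_last _)

open Classical in
/-- The shape of the fence that a relation `R` between neighbours defines on the elements
`e 0, …, e n`: the letter `l` says whether `e l` is below `e (l + 1)`. -/
noncomputable def shape (R : α → α → Prop) (e : Fin (n + 1) ≃ α) (l : Fin n) : Bool :=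
  decide (R (e l.castSucc) (e l.succ))

theorem shape_eq_true_iff {R : α → α → Prop} {l : Fin n} :
    shape R e l = true ↔ R (e l.castSucc) (e l.succ) := by
  simp [shape]

theorem shape_eq_false_iff {R : α → α → Prop} (hasymm : ∀ x y, R x y → ¬ R y x)
    (htotal : ∀ x y, NextAlong f x y → R x y ∨ R y x) (he : StrictMono (f ∘ e)) {l : Fin n} :
    shape R e l = false ↔ R (e l.succ) (e l.castSucc) := by
  rw [← Bool.not_eq_true, shape_eq_true_iff]
  exact ⟨(htotal _ _ ((nextAlong_iff_val_eq he).2 rfl)).resolve_left, hasymm _ _⟩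

theorem rel_iff_fenceStep_shape {R : α → α → Prop}
    (hneighbours : ∀ x y, R x y → NextAlong f x y ∨ NextAlong f y x)
    (hasymm : ∀ x y, R x y → ¬ R y x) (htotal : ∀ x y, NextAlong f x y → R x y ∨ R y x)
    (he : StrictMono (f ∘ e)) (i j : Fin (n + 1)) :
    R (e i) (e j) ↔ FenceStep (shape R e) i j := by
  refine ⟨fun h => ?_, ?_⟩
  · rcases hneighbours _ _ h with hij | hji
    · rw [nextAlong_iff_val_eq he] at hij
      obtain ⟨l, rfl⟩ := i.eq_castSucc_of_ne_last (Fin.ne_of_val_ne (by simp; omega))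
      obtain rfl : j = l.succ := Fin.ext hij
      exact .rise l (shape_eq_true_iff.2 h)
    · rw [nextAlong_iff_val_eq he] at hji
      obtain ⟨l, rfl⟩ := j.eq_castSucc_of_ne_last (Fin.ne_of_val_ne (by simp; omega))
      obtain rfl : i = l.succ := Fin.ext hji
      exact .fall l ((shape_eq_false_iff hasymm htotal he).2 h)
  · rintro (⟨l, hl⟩ | ⟨l, hl⟩)
    · exact shape_eq_true_iff.1 hl
    · exact (shape_eq_false_iff hasymm htotal he).1 hl

end Enumeration

namespace Fence

variable {k : ℕ} {p q : ℤ}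

instance : Finite (Fence k p q) :=
  Finite.of_injective (fun x => (x.crossing, x.level)) fun _ _ h =>
    Fence.ext (Prod.mk.inj h).1 (Prod.mk.inj h).2

theorem place_le {x y : Fence k p q} : place x ≤ place y ↔ x.crossing.t < y.crossing.t ∨
    (x.crossing.t = y.crossing.t ∧ x.level ≤ y.level) := by
  simp [place, Prod.Lex.toLex_le_toLex]

theorem isFirst_iff_forall_place_le {x : Fence k p q} :
    x.IsFirst ↔ ∀ y : Fence k p q, place x ≤ place y := by
  simp only [IsFirst, place_le]
  refine ⟨fun h y => ?_, fun h => ⟨?_, fun d => ?_⟩⟩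
  · exact (h.2 y.crossing).lt_or_eq.imp_right fun ht => ⟨ht, h.1 ▸ Fin.zero_le _⟩
  · simpa using h ⟨x.crossing, 0⟩
  · exact (h ⟨d, 0⟩).elim le_of_lt fun ht => ht.1.le

theorem isLast_iff_forall_place_le {x : Fence k p q} :
    x.IsLast ↔ ∀ y : Fence k p q, place y ≤ place x := by
  simp only [IsLast, place_le]
  refine ⟨fun h y => ?_, fun h => ⟨?_, fun d => ?_⟩⟩
  · exact (h.2 y.crossing).lt_or_eq.imp_right fun ht => ⟨ht, h.1 ▸ Fin.le_last _⟩
  · simpa using h ⟨x.crossing, Fin.last k⟩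
  · exact (h ⟨d, 0⟩).elim le_of_lt fun ht => ht.1.le

theorem IsFirst.eq {x y : Fence k p q} (hx : x.IsFirst) (hy : y.IsFirst) : x = y :=
  place_injective (le_antisymm (isFirst_iff_forall_place_le.1 hx y)
    (isFirst_iff_forall_place_le.1 hy x))

theorem IsLast.eq {x y : Fence k p q} (hx : x.IsLast) (hy : y.IsLast) : x = y :=
  place_injective (le_antisymm (isLast_iff_forall_place_le.1 hy x)
    (isLast_iff_forall_place_le.1 hx y))

theorem exists_isFirst_isLast [Nonempty (Fence k p q)] :
    ∃ x₀ x₁ : Fence k p q, x₀.IsFirst ∧ x₁.IsLast := by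
  obtain ⟨x₀, h₀⟩ := Finite.exists_min (place : Fence k p q → _)
  obtain ⟨x₁, h₁⟩ := Finite.exists_max (place : Fence k p q → _)
  exact ⟨x₀, x₁, isFirst_iff_forall_place_le.2 h₀, isLast_iff_forall_place_le.2 h₁⟩

/-- The map of the fence that is induced by the half turn about the midpoint of `γ`. -/
@[simps]
def rotate (x : Fence k p q) : Fence k p q := ⟨x.crossing.rotate, x.level.rev⟩

theorem rotate_involutive : Function.Involutive (rotate : Fence k p q → Fence k p q) :=
  fun _ => Fence.ext (Crossing.rotate_rotate _) (Fin.rev_rev _)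

theorem place_rotate_lt {x y : Fence k p q} (h : place x < place y) :
    place y.rotate < place x.rotate := by
  rw [place_lt] at h ⊢
  simp only [rotate_crossing, rotate_level, Crossing.rotate_t, Fin.rev_lt_rev, sub_lt_sub_iff_left,
    sub_right_inj]
  exact h.imp_right (And.imp_left Eq.symm)

theorem Step.rotate (hpq : IsCoprime p q) {x y : Fence k p q} (h : Step x y)
    (hmid : x.crossing = y.crossing → x.crossing.t ≠ 1 / 2) : Step x.rotate y.rotate := by
  cases h with
  | chainDown c i h =>
    simpa only [Fence.rotate, Fin.rev_succ, Fin.rev_castSucc] using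
      Step.chainUp c.rotate i.rev ((Crossing.closerToRight_rotate hpq (hmid rfl)).not_left.2 h)
  | chainUp c i h =>
    simpa only [Fence.rotate, Fin.rev_succ, Fin.rev_castSucc] using
      Step.chainDown c.rotate i.rev ((Crossing.closerToRight_rotate hpq (hmid rfl)).2 h)
  | linkDown c c' v h hc hc' hv =>
    simpa only [Fence.rotate, Fin.rev_zero, Fin.rev_last] using
      Step.linkUp (k := k) c'.rotate c.rotate _ h.rotate (Crossing.isEndpoint_rotate hc')
        (Crossing.isEndpoint_rotate hc) (leftOf_sub.2 hv)
  | linkUp c c' v h hc hc' hv =>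
    simpa only [Fence.rotate, Fin.rev_zero, Fin.rev_last] using
      Step.linkDown (k := k) c'.rotate c.rotate _ h.rotate (Crossing.isEndpoint_rotate hc')
        (Crossing.isEndpoint_rotate hc) (rightOf_sub.2 hv)

theorem step_or_step_of_nextAlong (hpq : IsCoprime p q) (hγ : ∀ d : Dir, d.level (p, q) ≠ 0)
    {x y : Fence k p q} (h : NextAlong place x y) : Step x y ∨ Step y x := by
  obtain ⟨c, i⟩ := x
  obtain ⟨c', j⟩ := y
  simp only [NextAlong, place_lt] at h
  obtain ⟨ht | ⟨ht, hij⟩, hnone⟩ := h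
  · obtain rfl : i = Fin.last k := by
      by_contra hi
      exact hnone ⟨c, Fin.last k⟩ ⟨.inr ⟨rfl, Fin.lt_last_iff_ne_last.2 hi⟩, .inl ht⟩
    obtain rfl : j = 0 := by
      by_contra hj
      exact hnone ⟨c', 0⟩ ⟨.inl ht, .inr ⟨rfl, Fin.pos_iff_ne_zero.2 hj⟩⟩
    have hcons : c.Consecutive c' := ⟨ht, fun d hd => hnone ⟨d, 0⟩ (hd.imp .inl .inl)⟩
    obtain ⟨v, hv, hv'⟩ := hcons.exists_common_endpoint hpq hγ
    rcases c.rightOf_or_leftOf hv with hside | hside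
    · exact .inr (.linkDown c c' v hcons hv hv' hside)
    · exact .inl (.linkUp c c' v hcons hv hv' hside)
  · obtain rfl : c = c' := Crossing.t_injective ht
    obtain ⟨l, rfl⟩ := i.eq_castSucc_of_ne_last (hij.trans_le (Fin.le_last j)).ne
    obtain rfl : j = l.succ := by
      by_contra hj
      exact hnone ⟨c, l.succ⟩ ⟨.inr ⟨rfl, Fin.castSucc_lt_succ⟩,
        .inr ⟨rfl, lt_of_le_of_ne (Fin.castSucc_lt_iff_succ_le.1 hij) (Ne.symm hj)⟩⟩
    by_cases hc : c.CloserToRight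
    · exact .inr (.chainDown c l hc)
    · exact .inl (.chainUp c l hc)

section Enumeration

variable {n : ℕ} {e : Fin (n + 1) ≃ Fence k p q}

theorem apply_rev (he : StrictMono (place ∘ e)) (i : Fin (n + 1)) : e i.rev = (e i).rotate :=
  apply_rev_eq_of_strictAnti_comp place_injective he rotate_involutive
    (fun _ _ => place_rotate_lt) i

theorem val_symm_apply (he : StrictMono (place ∘ e)) (c : Crossing p q) (j : Fin (k + 1)) :
    (e.symm ⟨c, j⟩ : ℕ) = e.symm ⟨c, 0⟩ + j := by
  induction j using Fin.induction with
  | zero => rfl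
  | succ j ih =>
    have hnext : NextAlong place (e (e.symm ⟨c, j.castSucc⟩)) (e (e.symm ⟨c, j.succ⟩)) := by
      rw [e.apply_symm_apply, e.apply_symm_apply]
      exact chain_neighbours c j
    rw [(nextAlong_iff_val_eq he).1 hnext, ih]
    rfl

theorem eq_two_mul_val_symm_add (he : StrictMono (place ∘ e)) {m : Crossing p q}
    (hm : m.t = 1 / 2) : n = 2 * (e.symm ⟨m, 0⟩ : ℕ) + k := by
  have hrev : (e.symm ⟨m, 0⟩).rev = e.symm ⟨m, Fin.last k⟩ := by
    rw [e.eq_symm_apply, apply_rev he, e.apply_symm_apply, rotate, Crossing.rotate_eq_self hm,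
      Fin.rev_zero]
  have hval := congrArg Fin.val hrev
  rw [val_symm_apply he m (Fin.last k), Fin.val_rev, Fin.val_last] at hval
  omega

theorem shape_eq_true_of_middle (he : StrictMono (place ∘ e)) {m : Crossing p q}
    (hm : m.t = 1 / 2) {l : Fin n} (hl : e.symm ⟨m, 0⟩ ≤ (l : ℕ))
    (hl' : l < (e.symm ⟨m, 0⟩ : ℕ) + k) : shape Step e l = true := by
  obtain ⟨j, hj⟩ : ∃ j : Fin k, (l : ℕ) = e.symm ⟨m, 0⟩ + j :=
    ⟨⟨l - e.symm ⟨m, 0⟩, by omega⟩, by simp only; omega⟩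
  have hcastSucc : e l.castSucc = ⟨m, j.castSucc⟩ :=
    e.symm_apply_eq.1 (Fin.ext ((val_symm_apply he m _).trans hj.symm)) |>.symm
  have hsucc : e l.succ = ⟨m, j.succ⟩ := by
    refine e.symm_apply_eq.1 (Fin.ext ((val_symm_apply he m _).trans ?_)) |>.symm
    simp only [Fin.val_succ, hj, add_assoc]
  rw [shape_eq_true_iff, hcastSucc, hsucc]
  exact .chainUp m j (Crossing.not_closerToRight hm)

theorem shape_rev (hpq : IsCoprime p q) (hγ : ∀ d : Dir, d.level (p, q) ≠ 0)
    (he : StrictMono (place ∘ e)) {m : Crossing p q} (hm : m.t = 1 / 2) {l : Fin n}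
    (hl : (l : ℕ) < e.symm ⟨m, 0⟩) : shape Step e l.rev = !shape Step e l := by
  have shape_false {l : Fin n} : shape Step e l = false ↔ Step (e l.succ) (e l.castSucc) :=
    shape_eq_false_iff Step.asymm (fun _ _ => step_or_step_of_nextAlong hpq hγ) he
  have hmid : (e l.castSucc).crossing.t ≠ 1 / 2 := by
    intro ht
    obtain rfl : (e l.castSucc).crossing = m := Crossing.t_injective (ht.trans hm.symm)
    have hpos := val_symm_apply he (e l.castSucc).crossing (e l.castSucc).level
    rw [e.symm_apply_apply l.castSucc] at hpos
    simp only [Fin.val_castSucc] at hpos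
    omega
  rcases hr : shape Step e l with _ | _
  · rw [shape_false] at hr
    rw [Bool.not_false, shape_eq_true_iff, ← Fin.rev_succ, ← Fin.rev_castSucc, apply_rev he,
      apply_rev he]
    exact hr.rotate hpq fun h => h ▸ hmid
  · rw [shape_eq_true_iff] at hr
    rw [Bool.not_true, shape_false, ← Fin.rev_succ, ← Fin.rev_castSucc, apply_rev he,
      apply_rev he]
    exact hr.rotate hpq fun _ => hmid

end Enumeration

theorem card_lowerSet_first_sub_last (hpq : IsCoprime p q) (hγ : ∀ d : Dir, d.level (p, q) ≠ 0)
    {x₀ x₁ : Fence k p q} (h₀ : x₀.IsFirst) (h₁ : x₁.IsLast) :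
    (Nat.card {I : LowerSet (Fence k p q) // x₀ ∈ I} : ℤ) -
      Nat.card {I : LowerSet (Fence k p q) // x₁ ∈ I} = k := by
  obtain ⟨m, hm⟩ := Crossing.exists_t_eq_half hpq hγ
  have : Nonempty (Fence k p q) := ⟨x₀⟩
  obtain ⟨n, e, he⟩ := exists_equiv_fin_strictMono (place_injective (k := k) (p := p) (q := q))
  obtain ⟨u, hu⟩ := ofFn_eq_append_replicate_append (eq_two_mul_val_symm_add he hm)
    (fun _ => shape_eq_true_of_middle he hm) (fun _ => shape_rev hpq hγ he hm)
  rw [eq_apply_zero_of_forall_le place_injective he (isFirst_iff_forall_place_le.1 h₀),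
    eq_apply_last_of_forall_le place_injective he (isLast_iff_forall_place_le.1 h₁)]
  exact card_lowerSet_mem_first_sub_last (fun _ _ => Iff.rfl)
    (rel_iff_fenceStep_shape Step.neighbours Step.asymm
      (fun _ _ => step_or_step_of_nextAlong hpq hγ) he) hu

end Fence

theorem bijective_withTop_upperSet {α : Type*} [LinearOrder α] [WellFoundedLT α] :
    Function.Bijective (WithTop.recTopCoe ⊤ UpperSet.Ici : WithTop α → UpperSet α) := by
  refine ⟨fun a b h => ?_, fun U => ?_⟩
  · induction a <;> induction b
    · rfl
    · exact absurd h.symm UpperSet.Ici_ne_top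
    · exact absurd h UpperSet.Ici_ne_top
    · exact congrArg _ (UpperSet.Ici_injective h)
  · rcases (U : Set α).eq_empty_or_nonempty with hU | hU
    · exact ⟨⊤, UpperSet.coe_eq_empty.1 hU |>.symm⟩
    · obtain ⟨a, ha, hmin⟩ := WellFounded.has_min wellFounded_lt (U : Set α) hU
      exact ⟨a, UpperSet.ext (Set.ext fun b =>
        ⟨fun hb => U.upper hb ha, fun hb => not_lt.1 (hmin b hb)⟩)⟩

theorem card_upperSet {α : Type*} [LinearOrder α] [Finite α] :
    Nat.card (UpperSet α) = Nat.card α + 1 :=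
  (Nat.card_eq_of_bijective _ bijective_withTop_upperSet).symm.trans Finite.card_option

theorem ncard_setOf_ne_and_imp {α β : Type*} [Finite α] [Finite β] (s t : Set α) {a b : β}
    (hab : a ≠ b) : ({z : α × β | (z.1 ∈ s → z.2 ≠ a) ∧ (z.2 = b → z.1 ∈ t)}.ncard : ℤ) =
      (Nat.card β - 1) * Nat.card α - s.ncard + t.ncard := by
  have hcompl : {z : α × β | (z.1 ∈ s → z.2 ≠ a) ∧ (z.2 = b → z.1 ∈ t)}ᶜ =
      s ×ˢ {a} ∪ tᶜ ×ˢ {b} := by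
    ext z
    simp only [Set.mem_compl_iff, Set.mem_ofPred_eq, Set.mem_union, Set.mem_prod,
      Set.mem_singleton_iff]
    tauto
  have hdisj : Disjoint (s ×ˢ {a}) (tᶜ ×ˢ {b}) :=
    Set.disjoint_prod.2 (.inr (Set.disjoint_singleton.2 hab))
  have htotal := Set.ncard_add_ncard_compl
    {z : α × β | (z.1 ∈ s → z.2 ≠ a) ∧ (z.2 = b → z.1 ∈ t)}
  rw [hcompl, Set.ncard_union_eq hdisj, Set.ncard_prod, Set.ncard_prod, Set.ncard_singleton,
    Set.ncard_singleton, mul_one, mul_one, Nat.card_prod] at htotal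
  have ht := Set.ncard_add_ncard_compl t
  zify at htotal ht
  linear_combination htotal - ht

theorem isUpperSet_fin_iff {n : ℕ} {S : Set (Fin (n + 1))} :
    IsUpperSet S ↔ ∀ i : Fin n, i.castSucc ∈ S → i.succ ∈ S :=
  isUpperSet_setOfPred.trans Fin.monotone_iff_le_succ

namespace Circular

variable {k : ℕ} {p q : ℤ} {x₀ x₁ : Fence k p q}

theorem isLowerSet_iff (h₀ : x₀.IsFirst) (h₁ : x₁.IsLast) {S : Set (Circular k p q)} :
    IsLowerSet S ↔ (IsLowerSet (fence ⁻¹' S) ∧ IsUpperSet (chain ⁻¹' S)) ∧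
      (fence x₀ ∈ S → chain ⊤ ∈ S) ∧ (chain ⊥ ∈ S → fence x₁ ∈ S) := by
  rw [isLowerSet_iff_of_le_iff_reflTransGen (R := Step) fun _ _ => Iff.rfl, isUpperSet_fin_iff]
  constructor
  · intro h
    exact ⟨⟨fun x y hyx => h _ _ (.fence y x hyx), fun i => h _ _ (.chain i)⟩,
      h _ _ (.toFirst x₀ h₀), h _ _ (.fromLast x₁ h₁)⟩
  · rintro ⟨⟨hfence, hchain⟩, hfirst, hlast⟩ _ _ (⟨x, y, hxy⟩ | ⟨i⟩ | ⟨x, hx⟩ | ⟨x, hx⟩)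
    · exact hfence hxy
    · exact hchain i
    · exact hx.eq h₀ ▸ hfirst
    · exact hx.eq h₁ ▸ hlast

/-- A lower set of the circular poset as a pair of a lower set of the fence and a final segment of
the chain; the latter is an upper set of indices because the chain decreases. -/
def lowerSetEquiv (h₀ : x₀.IsFirst) (h₁ : x₁.IsLast) : LowerSet (Circular k p q) ≃
    {z : LowerSet (Fence k p q) × UpperSet (Fin (3 * k + 3)) //
      (x₀ ∈ z.1 → ⊤ ∈ z.2) ∧ (⊥ ∈ z.2 → x₁ ∈ z.1)} where
  toFun J :=
    have hJ := (isLowerSet_iff h₀ h₁).1 J.lower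
    ⟨(⟨{x | fence x ∈ J}, hJ.1.1⟩, ⟨{i | chain i ∈ J}, hJ.1.2⟩), hJ.2⟩
  invFun z :=
    { carrier := {y | match y with
        | chain i => i ∈ z.1.2
        | fence x => x ∈ z.1.1}
      lower' := (isLowerSet_iff h₀ h₁).2 ⟨⟨z.1.1.lower, z.1.2.upper⟩, z.2⟩ }
  left_inv J := LowerSet.ext (Set.ext fun y => by cases y <;> rfl)
  right_inv _ := rfl

theorem card_lowerSet (h₀ : x₀.IsFirst) (h₁ : x₁.IsLast) :
    (Nat.card (LowerSet (Circular k p q)) : ℤ) = (3 * k + 3) * markov k p q -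
      Nat.card {I : LowerSet (Fence k p q) // x₀ ∈ I} +
      Nat.card {I : LowerSet (Fence k p q) // x₁ ∈ I} := by
  have hends : (⊤ : UpperSet (Fin (3 * k + 3))) ≠ ⊥ := fun h =>
    Set.empty_ne_univ (congrArg UpperSet.carrier h)
  have htop (U : UpperSet (Fin (3 * k + 3))) : ⊤ ∈ U ↔ U ≠ ⊤ := by
    rw [← SetLike.mem_coe, U.upper.top_mem, Set.nonempty_iff_ne_empty, Ne,
      UpperSet.coe_eq_empty]
  have hbot (U : UpperSet (Fin (3 * k + 3))) : ⊥ ∈ U ↔ U = ⊥ := by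
    rw [← SetLike.mem_coe, U.upper.bot_mem, UpperSet.coe_eq_univ]
  rw [Nat.card_congr (lowerSetEquiv h₀ h₁)]
  simp only [htop, hbot]
  refine (ncard_setOf_ne_and_imp {I | x₀ ∈ I} {I | x₁ ∈ I} hends).trans ?_
  rw [card_upperSet, Nat.card_fin, ← Nat.card_coe_set_eq, ← Nat.card_coe_set_eq]
  push_cast
  rw [add_sub_cancel_right]
  rfl

end Circular

end KMarkov

theorem lemma3 (k : ℕ) (p q : ℤ) (hpq : IsCoprime p q)
    (hp : p ≠ 0) (hq : q ≠ 0) (hsum : p + q ≠ 0) :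
    (Nat.card (LowerSet (KMarkov.Circular k p q)) : ℤ)
      = (3 + 3 * (k : ℤ)) * (KMarkov.markov k p q : ℤ) - (k : ℤ) := by
  have hγ : ∀ d : KMarkov.Dir, d.level (p, q) ≠ 0 := KMarkov.Dir.forall.2 ⟨hq, hp, hsum⟩
  obtain ⟨m, -⟩ := KMarkov.Crossing.exists_t_eq_half hpq hγ
  have : Nonempty (KMarkov.Fence k p q) := ⟨⟨m, 0⟩⟩
  obtain ⟨x₀, x₁, h₀, h₁⟩ := KMarkov.Fence.exists_isFirst_isLast (k := k) (p := p) (q := q)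
  rw [KMarkov.Circular.card_lowerSet h₀ h₁]
  linear_combination -KMarkov.Fence.card_lowerSet_first_sub_last hpq hγ h₀ h₁
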